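/- Let $S=\mathbb{C}[x,y,z]$ with its standard grading, and let $\mathcal{L}\subset\mathbb{P}^2_{\mathbb{C}}$ be an arrangement of $d\ge 4$ pairwise distinct lines with equation $f=0$, where $f\in S$ is the product of linear forms defining the lines. Let $J_f=(f_x,f_y,f_z)$ be its Jacobian ideal, let $\widehat{J_f}=\{g\in S:\ (x,y,z)^n g\subseteq J_f \text{ for some } n\ge 0\}$ be the saturation of $J_f$, put $N(f)=\widehat{J_f}/J_f$, and define the defect of $\mathcal{L}$ by $$\nu(\mathcal{L})=\max_{k\ge 0}\dim_{\mathbb{C}}N(f)_k .$$ Assume that $\mathcal{L}$ is plus--one generated with exponents $(d_1,d_2,d_3)$, that is, $1\le d_1\le d_2\le d_3$ are integers with $d_1+d_2=d$, and the Milnor algebra $S/J_f$ has a minimal graded free resolution of the form $$0\to S(-e)\to\bigoplus_{i=1}^{3}S(1-d-d_i)\to S^3(1-d)\to S\to S/J_f\to 0$$ for some integer $e$. Then the maximum defining $\nu(\mathcal{L})$ exists, and $$\nu(\mathcal{L})=d_3-d_2+1 .$$ -/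

import Mathlib

namespace PlaneCurve

/-- The polynomial ring `S = ℂ[x, y, z]`. -/
abbrev S : Type := MvPolynomial (Fin 3) ℂ

/-- An arrangement of `d` pairwise distinct lines in the complex projective plane. The `i`-th line
is `{[x : y : z] | a x + b y + c z = 0}` with `(a, b, c) = coeff i`; two such lines are distinct iff
their coefficient vectors are not proportional. -/
structure LineArrangement (d : ℕ) where
  coeff : Fin d → Fin 3 → ℂ
  coeff_ne_zero : ∀ i, coeff i ≠ 0
  distinct : ∀ i j, i ≠ j → LinearIndependent ℂ ![coeff i, coeff j]

/-- The equation of the arrangement: the product of the linear forms defining its lines. -/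
noncomputable def LineArrangement.equation {d : ℕ} (L : LineArrangement d) : S :=
  ∏ i : Fin d, ∑ j : Fin 3, MvPolynomial.C (L.coeff i j) * MvPolynomial.X j

/-- The map `S³ → S`, `(a, b, c) ↦ a f_x + b f_y + c f_z`; its kernel is `AR(f)` and its range is
the Jacobian ideal. -/
noncomputable def jacobianMap (f : S) : (Fin 3 → S) →ₗ[S] S :=
  ∑ i : Fin 3, (LinearMap.proj i).smulRight (MvPolynomial.pderiv i f)

/-- The Jacobian ideal `J_f = (f_x, f_y, f_z)`. -/
noncomputable def jacobianIdeal (f : S) : Ideal S :=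
  Ideal.span (Set.range fun i : Fin 3 => MvPolynomial.pderiv i f)

/-- The irrelevant maximal ideal `(x, y, z)`. -/
noncomputable def irrelevantIdeal : Ideal S :=
  Ideal.span (Set.range (MvPolynomial.X : Fin 3 → S))

/-- The saturation of an ideal `I` with respect to `𝔪 = (x, y, z)`: all `g` with `𝔪ⁿ g ⊆ I` for
some `n`. -/
noncomputable def saturation (I : Ideal S) : Ideal S where
  carrier := {g | ∃ n : ℕ, ∀ h ∈ irrelevantIdeal ^ n, h * g ∈ I}
  zero_mem' := ⟨0, fun h _ => by simp⟩
  add_mem' := by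
    rintro a b ⟨n, hn⟩ ⟨m, hm⟩
    refine ⟨max n m, fun h hh => ?_⟩
    rw [mul_add]
    exact I.add_mem (hn h (Ideal.pow_le_pow_right (le_max_left n m) hh))
      (hm h (Ideal.pow_le_pow_right (le_max_right n m) hh))
  smul_mem' := by
    rintro c a ⟨n, hn⟩
    refine ⟨n, fun h hh => ?_⟩
    rw [smul_eq_mul, mul_left_comm]
    exact I.mul_mem_left c (hn h hh)

/-- The degree `k` part `I_k = I ∩ S_k` of an ideal, as a complex vector space. -/
noncomputable def degreePart (I : Ideal S) (k : ℕ) : Submodule ℂ S :=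
  I.restrictScalars ℂ ⊓ MvPolynomial.homogeneousSubmodule (Fin 3) ℂ k

/-- `n(f)_k = dim N(f)_k`, where `N(f) = Ĵ / J`, with `J` the Jacobian ideal of `f` and `Ĵ` its
saturation; `N(f)_k` is the quotient of `Ĵ_k` by its subspace `J_k`. -/
noncomputable def dimN (f : S) (k : ℕ) : ℕ :=
  Module.finrank ℂ (degreePart (saturation (jacobianIdeal f)) k ⧸
    (degreePart (jacobianIdeal f) k).comap
      (degreePart (saturation (jacobianIdeal f)) k).subtype)

/-- The defect `ν(C) = max_k dim N(f)_k` of the curve `C : f = 0`. -/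
noncomputable def defect (f : S) : ℕ :=
  sSup (Set.range (dimN f))

/-- The matrix `A` describes a degree-preserving `S`-linear map
`⨁ⱼ S(n j) → ⨁ᵢ S(m i)` of graded free modules: the entry `A i j` is homogeneous of degree
`m i - n j`, hence zero if this integer is negative. -/
def IsGradedMatrix {ι κ : Type} (m : ι → ℤ) (n : κ → ℤ) (A : Matrix ι κ S) : Prop :=
  ∀ i j, A i j = 0 ∨ ∃ k : ℕ, (k : ℤ) = m i - n j ∧ (A i j).IsHomogeneous k

/-- The reduced plane curve `f = 0` of degree `d` is an `m`-syzygy curve with exponents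
`exps 0 ≤ exps 1 ≤ ⋯`: the Milnor algebra `S / J_f` has a minimal graded free resolution
`0 → ⨁ S(-eᵢ) → ⨁ S(1 - d - exps i) → S³(1 - d) → S → S / J_f → 0`.

The last map to `S` is given by the partial derivatives (up to a change of basis of `S³(1 - d)` this
is the only possibility). Minimality of the resolution means that all
matrix entries lie in the maximal ideal `(x, y, z)`, i.e. have no constant term. -/
def IsSyzygyCurve (f : S) (d m : ℕ) (exps : Fin m → ℕ) : Prop :=
  f.IsHomogeneous d ∧ Squarefree f ∧ Monotone exps ∧ (∀ i, 1 ≤ exps i) ∧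
  ∃ (e : Fin (m - 2) → ℤ) (A : Matrix (Fin 3) (Fin m) S) (B : Matrix (Fin m) (Fin (m - 2)) S),
    Monotone e ∧
    -- the maps preserve degrees
    IsGradedMatrix (fun _ => 1 - (d : ℤ)) (fun j => 1 - (d : ℤ) - exps j) A ∧
    IsGradedMatrix (fun i => 1 - (d : ℤ) - exps i) (fun j => - e j) B ∧
    -- the complex is exact
    LinearMap.ker (jacobianMap f) = LinearMap.range A.mulVecLin ∧
    LinearMap.ker A.mulVecLin = LinearMap.range B.mulVecLin ∧
    LinearMap.ker B.mulVecLin = ⊥ ∧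
    -- the resolution is minimal
    (∀ i, MvPolynomial.constantCoeff (MvPolynomial.pderiv i f) = 0) ∧
    (∀ i j, MvPolynomial.constantCoeff (A i j) = 0) ∧
    (∀ i j, MvPolynomial.constantCoeff (B i j) = 0)

/-- The reduced plane curve `f = 0` of degree `d` is plus-one generated with exponents
`(d₁, d₂, d₃)`: it is a 3-syzygy curve with these exponents and `d₁ + d₂ = d`. -/
def IsPlusOneGenerated (f : S) (d d₁ d₂ d₃ : ℕ) : Prop :=
  IsSyzygyCurve f d 3 ![d₁, d₂, d₃] ∧ d₁ + d₂ = d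

end PlaneCurve

/-! Let φ be the gradient of f, `A` the 3×3 matrix whose columns generate the syzygies of φ, and `b`
the single relation between these columns. The Hilbert–Burch relation says that the maximal minors
of `A` are the products `b i * φ j` up to sign and a common unit. Comparing degrees, and using d₁ +
d₂ = d, gives `b 0`, `b 1`, `b 2` the degrees d₃ - d₁ + 1, d₃ - d₂ + 1 and 1.

Exactness and minimality make `b 2` a nonzero linear form modulo which `b 0` and `b 1` are coprime,
so the Koszul complex of `b` is exact (`koszulExact_of_quotient`). Since `A` kills `b`, it factors
as `C * skew b`, and then φ `C` = g₀ `b` for a single form g₀. Comparing Koszul complexes with the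
resolution shows that g₀ generates the saturation modulo J_f (`exists_eq_mul_of_mem_saturation`) and
that its annihilator modulo J_f is (`b 0`, `b 1`, `b 2`)
(`exists_combination_of_mul_generator_mem`).

Hence N(f) is, up to a shift, S/(`b`): the quotient of a polynomial ring in two variables by coprime
forms of degrees p ≥ q = d₃ - d₂ + 1. Its Hilbert function is j + 1 for j < q and never exceeds q
afterwards (`isGreatest_dimN`). -/

namespace PlaneCurve

open Matrix

/-! ### Exactness of Koszul complexes on three elements -/

section Koszul

variable {R : Type*} [CommRing R]

/-- The common divisors of the entries of `v` are units. -/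
def IsPrimitive {ι : Type*} (v : ι → R) : Prop := ∀ p, (∀ i, p ∣ v i) → IsUnit p

/-- The matrix of the cross product with `a`. -/
def skew (a : Fin 3 → R) : Matrix (Fin 3) (Fin 3) R :=
  !![0, -a 2, a 1; a 2, 0, -a 0; -a 1, a 0, 0]

/-- The Koszul complex of `a` has vanishing first homology. -/
def KoszulExact (a : Fin 3 → R) : Prop := ∀ v : Fin 3 → R, v ⬝ᵥ a = 0 → ∃ w, v = w ᵥ* skew a

lemma skew_mulVec_self (a : Fin 3 → R) : skew a *ᵥ a = 0 := by
  ext i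
  fin_cases i <;> simp [skew, mulVec, dotProduct, Fin.sum_univ_three] <;> ring

lemma self_vecMul_skew (a : Fin 3 → R) : a ᵥ* skew a = 0 := by
  ext i
  fin_cases i <;> simp [skew, vecMul, dotProduct, Fin.sum_univ_three] <;> ring

lemma KoszulExact.exists_matrix {a : Fin 3 → R} (ha : KoszulExact a)
    {M : Matrix (Fin 3) (Fin 3) R} (hM : M *ᵥ a = 0) : ∃ E, M = E * skew a := by
  choose w hw using fun i => ha (M i) (congrFun hM i)
  exact ⟨Matrix.of w, by ext i j; exact congrFun (hw i) j⟩

lemma koszulExact_of_isUnit {a : Fin 3 → R} (h : IsUnit (a 0)) : KoszulExact a := by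
  intro v hv
  obtain ⟨c, hc⟩ := h.exists_right_inv
  refine ⟨![0, -(c * v 2), c * v 1], ?_⟩
  simp only [dotProduct, Fin.sum_univ_three] at hv
  ext i
  fin_cases i <;> simp [skew, vecMul, dotProduct, Fin.sum_univ_three]
  · linear_combination (-v 0) * hc + c * hv
  · linear_combination (-v 1) * hc
  · linear_combination (-v 2) * hc

lemma KoszulExact.rotate {a : Fin 3 → R} (h : KoszulExact a) : KoszulExact ![a 1, a 2, a 0] := by
  intro v hv
  obtain ⟨w, hw⟩ := h ![v 2, v 0, v 1] (by
    simp only [dotProduct, Fin.sum_univ_three] at hv ⊢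
    simp at hv ⊢
    linear_combination hv)
  refine ⟨![w 1, w 2, w 0], ?_⟩
  have h0 := congrFun hw 0
  have h1 := congrFun hw 1
  have h2 := congrFun hw 2
  simp [skew, vecMul, dotProduct, Fin.sum_univ_three] at h0 h1 h2
  ext i
  fin_cases i <;> simp [skew, vecMul, dotProduct, Fin.sum_univ_three]
  · linear_combination h1
  · linear_combination h2
  · linear_combination h0

/-- A relation on (aa', b, c) becomes one on (a, b, c) by moving a' into its first coefficient.
Writing that relation as a Koszul one expresses `v 0 * a'` through b and c, which is a relation on
(a', b, c). -/
lemma KoszulExact.mul {a a' b c : R} (h : KoszulExact ![a, b, c]) (h' : KoszulExact ![a', b, c]) :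
    KoszulExact ![a * a', b, c] := by
  intro v hv
  simp [dotProduct, Fin.sum_univ_three] at hv
  obtain ⟨E, hE⟩ := h ![v 0 * a', v 1, v 2] (by
    simp [dotProduct, Fin.sum_univ_three]
    linear_combination hv)
  have h0 := congrFun hE 0
  have h1 := congrFun hE 1
  have h2 := congrFun hE 2
  simp [skew, vecMul, dotProduct, Fin.sum_univ_three] at h0 h1 h2
  obtain ⟨F, hF⟩ := h' ![v 0, E 2, -E 1] (by
    simp [dotProduct, Fin.sum_univ_three]
    linear_combination h0)
  have k0 := congrFun hF 0
  have k1 := congrFun hF 1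
  have k2 := congrFun hF 2
  simp [skew, vecMul, dotProduct, Fin.sum_univ_three] at k0 k1 k2
  refine ⟨![E 0 + a * F 0, F 1, F 2], ?_⟩
  ext i
  fin_cases i <;> simp [skew, vecMul, dotProduct, Fin.sum_univ_three]
  · linear_combination k0
  · linear_combination h1 + a * k1
  · linear_combination h2 + a * k2

lemma KoszulExact.pow_left {a b c : R} (h : KoszulExact ![a, b, c]) (n : ℕ) :
    KoszulExact ![a ^ n, b, c] := by
  induction n with
  | zero => exact koszulExact_of_isUnit (by simp)
  | succ n ih => rw [pow_succ]; exact ih.mul h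

lemma KoszulExact.pow {a b c : R} (h : KoszulExact ![a, b, c]) (n : ℕ) :
    KoszulExact ![a ^ n, b ^ n, c ^ n] := by
  have h1 : KoszulExact ![b, c, a ^ n] := by simpa using (h.pow_left n).rotate
  have h2 : KoszulExact ![c, a ^ n, b ^ n] := by simpa using (h1.pow_left n).rotate
  simpa using (h2.pow_left n).rotate

end Koszul

/-! ### Vectors without common factor over a factorial domain -/

section Primitive

variable {R : Type*} [CommRing R] [IsDomain R] {ι : Type*}

lemma IsPrimitive.exists_ne_zero {v : ι → R} (hv : IsPrimitive v) : ∃ i, v i ≠ 0 := by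
  by_contra! h
  exact not_isUnit_zero (hv 0 fun i => by simp [h i])

variable [UniqueFactorizationMonoid R]

/-- Each prime factor of `a` misses some entry of `v`, so it divides `w` and can be cancelled. -/
lemma IsPrimitive.dvd {v : ι → R} (hv : IsPrimitive v) (a w : R) (h : ∀ i, a ∣ w * v i) :
    a ∣ w := by
  induction a using UniqueFactorizationMonoid.induction_on_prime generalizing w with
  | h₁ =>
    obtain ⟨i, hi⟩ := hv.exists_ne_zero
    have := zero_dvd_iff.mp (h i)
    rw [(mul_eq_zero.mp this).resolve_right hi]
  | h₂ a ha => exact ha.dvd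
  | h₃ a p _ hp ih =>
    have : ¬ ∀ i, p ∣ v i := fun h' => hp.not_isUnit (hv p h')
    push Not at this
    obtain ⟨i, hi⟩ := this
    obtain ⟨w, rfl⟩ := (hp.dvd_or_dvd ((dvd_mul_right p a).trans (h i))).resolve_right hi
    refine mul_dvd_mul_left p (ih w fun j => ?_)
    exact (mul_dvd_mul_iff_left hp.ne_zero).mp (by simpa only [mul_assoc] using h j)

lemma IsPrimitive.exists_smul {v : ι → R} (hv : IsPrimitive v) {w : ι → R}
    (h : ∀ i j, v i * w j = v j * w i) : ∃ t : R, w = t • v := by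
  obtain ⟨i, hi⟩ := hv.exists_ne_zero
  obtain ⟨t, ht⟩ := hv.dvd (v i) (w i) fun j => ⟨w j, by rw [h i j, mul_comm]⟩
  refine ⟨t, funext fun j => mul_left_cancel₀ hi ?_⟩
  rw [h i j, ht, Pi.smul_apply, smul_eq_mul]
  ring

lemma IsPrimitive.exists_smul_of_vecMul_skew {a : Fin 3 → R} (ha : IsPrimitive a) {v : Fin 3 → R}
    (h : v ᵥ* skew a = 0) : ∃ t : R, v = t • a := by
  have h0 := congrFun h 0
  have h1 := congrFun h 1
  have h2 := congrFun h 2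
  simp [skew, vecMul, dotProduct, Fin.sum_univ_three] at h0 h1 h2
  refine ha.exists_smul fun i j => ?_
  fin_cases i <;> fin_cases j <;> simp <;> grind

lemma IsPrimitive.exists_vecMulVec {a : Fin 3 → R} (ha : IsPrimitive a)
    {M : Matrix (Fin 3) (Fin 3) R} (h : M * skew a = 0) : ∃ t, M = vecMulVec t a := by
  choose t ht using fun i => ha.exists_smul_of_vecMul_skew (v := M i) (congrFun h i)
  exact ⟨t, by ext i j; exact congrFun (ht i) j⟩

end Primitive

/-! ### Diagram chases comparing Koszul complexes with the resolution -/

section SyzygyMatrix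

variable {R : Type*} [CommRing R]

/-- `0 → R → R³ → R³ → R` is exact, where the maps are given by `b`, `A` and `φ`. -/
structure IsSyzygyMatrix (φ : Fin 3 → R) (A : Matrix (Fin 3) (Fin 3) R) (b : Fin 3 → R) :
    Prop where
  vecMul_eq : φ ᵥ* A = 0
  mulVec_eq : A *ᵥ b = 0
  lift : ∀ v : Fin 3 → R, φ ⬝ᵥ v = 0 → ∃ c, v = A *ᵥ c
  lift' : ∀ v : Fin 3 → R, A *ᵥ v = 0 → ∃ s : R, v = s • b
  ne_zero : b ≠ 0

namespace IsSyzygyMatrix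

variable {φ b : Fin 3 → R} {A : Matrix (Fin 3) (Fin 3) R} (H : IsSyzygyMatrix φ A b)

include H

lemma exists_matrix {M : Matrix (Fin 3) (Fin 3) R} (hM : φ ᵥ* M = 0) : ∃ D, M = A * D := by
  choose c hc using fun j => H.lift (fun i => M i j) (congrFun hM j)
  exact ⟨Matrix.of fun i j => c j i, by ext i j; exact congrFun (hc j) i⟩

lemma exists_vecMulVec {M : Matrix (Fin 3) (Fin 3) R} (hM : A * M = 0) :
    ∃ s, M = vecMulVec b s := by
  choose s hs using fun j => H.lift' (fun i => M i j) (by ext i; exact congrFun (congrFun hM i) j)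
  exact ⟨s, by ext i j; simpa [vecMulVec, mul_comm] using congrFun (hs j) i⟩

variable {C : Matrix (Fin 3) (Fin 3) R} {g₀ : R}

/-- This bounds the annihilator of g₀. Multiplication by h on the resolution is null-homotopic: `V`
and `s` are the homotopies, and one diagonal entry of h·1 = `V * skew b` + b sᵀ exhibits h in the
ideal of `b`. -/
lemma exists_combination_of_mul_generator_mem (hC : A = C * skew b) (hg : φ ᵥ* C = g₀ • b)
    {h : R} {t : Fin 3 → R} (ht : φ ⬝ᵥ t = h * g₀) : ∃ s : Fin 3 → R, h = s ⬝ᵥ b := by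
  obtain ⟨V, hV⟩ := H.exists_matrix (M := h • C - vecMulVec t b) (by
    rw [vecMul_sub, vecMul_smul, hg, vecMul_vecMulVec, ht, smul_smul, sub_self])
  obtain ⟨s, hs⟩ := H.exists_vecMulVec (M := h • (1 : Matrix (Fin 3) (Fin 3) R) - V * skew b) (by
    rw [Matrix.mul_sub, ← Matrix.mul_assoc, ← hV, Matrix.sub_mul, Matrix.smul_mul, ← hC,
      vecMulVec_mul, self_vecMul_skew, vecMulVec_zero, Matrix.mul_smul, Matrix.mul_one, sub_zero,
      sub_self])
  have := congrFun (congrFun hs 0) 0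
  simp [Matrix.mul_apply, Fin.sum_univ_three, skew, vecMulVec] at this
  refine ⟨![s 0, -V 0 2, V 0 1], ?_⟩
  simp [dotProduct, Fin.sum_univ_three]
  linear_combination this

variable [IsDomain R]

lemma isPrimitive : IsPrimitive b := by
  intro p hp
  choose b' hb' using hp
  have hb : b = p • b' := funext hb'
  have hp0 : p ≠ 0 := by
    rintro rfl
    exact H.ne_zero (by rw [hb, zero_smul])
  obtain ⟨s, hs⟩ := H.lift' b' (by
    have := H.mulVec_eq
    rw [hb, mulVec_smul] at this
    exact (smul_eq_zero.mp this).resolve_left hp0)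
  obtain ⟨i, hi⟩ := Function.ne_iff.mp H.ne_zero
  refine IsUnit.of_mul_eq_one s (mul_right_cancel₀ hi ?_)
  have := hb' i
  rw [hs] at this
  simp only [Pi.smul_apply, smul_eq_mul] at this
  linear_combination -this

variable [UniqueFactorizationMonoid R]

/-- Multiplication by g lifts to a chain map (`C`, `D`, h) from the Koszul complex of `a` to the
resolution. After scaling by `b m` its last component is divisible by `b`, which yields a homotopy.
It transfers membership from powers of the variables to the entries of `b`. -/
lemma mul_mem_of_koszulExact {a : Fin 3 → R} (ha : KoszulExact a) (ha' : IsPrimitive a) {g : R}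
    (hg : ∀ j, ∃ c : Fin 3 → R, φ ⬝ᵥ c = g * a j) (m : Fin 3) :
    ∃ t : Fin 3 → R, φ ⬝ᵥ t = g * b m := by
  choose c hc using hg
  set C : Matrix (Fin 3) (Fin 3) R := Matrix.of fun i j => c j i
  have hC : φ ᵥ* C = g • a := funext hc
  obtain ⟨D, hD⟩ := H.exists_matrix (M := C * skew a) (by
    rw [← vecMul_vecMul, hC, smul_vecMul, self_vecMul_skew, smul_zero])
  obtain ⟨h, hh⟩ := H.lift' (D *ᵥ a) (by
    rw [mulVec_mulVec, ← hD, ← mulVec_mulVec, skew_mulVec_self, mulVec_zero])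
  have hm : D m ⬝ᵥ a = h * b m := congrFun hh m
  -- The rank-one correction makes the matrix kill `a`, and it is itself killed by `A`.
  obtain ⟨E, hE⟩ := ha.exists_matrix (M := b m • D - vecMulVec b (D m)) (by
    rw [sub_mulVec, smul_mulVec, hh, vecMulVec_mulVec, hm]
    ext i
    simp
    ring)
  have hA : A * vecMulVec b (D m) = 0 := by
    rw [mul_vecMulVec, H.mulVec_eq, zero_vecMulVec]
  obtain ⟨t, ht⟩ := ha'.exists_vecMulVec (M := b m • C - A * E) (by
    rw [Matrix.sub_mul, Matrix.mul_assoc, ← hE, Matrix.mul_sub, hA, Matrix.smul_mul, hD,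
      Matrix.mul_smul, sub_zero, sub_self])
  refine ⟨t, ?_⟩
  obtain ⟨i, hi⟩ := ha'.exists_ne_zero
  have key : φ ᵥ* (b m • C - A * E) = φ ᵥ* vecMulVec t a := by rw [ht]
  rw [vecMul_sub, vecMul_smul, hC, ← vecMul_vecMul, H.vecMul_eq, zero_vecMul, sub_zero,
    vecMul_vecMulVec] at key
  have := congrFun key i
  simp at this
  refine mul_right_cancel₀ hi ?_
  linear_combination -this

/-- If the Koszul complex of `b` is exact, then `A` factors through it, and the factor `C`
determines a generator of the saturation modulo the ideal generated by `φ`. -/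
lemma exists_generator (hb : KoszulExact b) :
    ∃ (C : Matrix (Fin 3) (Fin 3) R) (g₀ : R), A = C * skew b ∧ φ ᵥ* C = g₀ • b := by
  obtain ⟨C, hC⟩ := hb.exists_matrix H.mulVec_eq
  obtain ⟨t, ht⟩ := H.isPrimitive.exists_smul_of_vecMul_skew (v := φ ᵥ* C) (by
    rw [vecMul_vecMul, ← hC, H.vecMul_eq])
  exact ⟨C, t, hC, ht⟩

/-- A second lift `C'`, for g instead of g₀, induces multiplication by some h on the last term. Thus
`C'` and h`C` differ by a homotopy, and g and h g₀ agree modulo the entries of φ. -/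
lemma exists_eq_mul_generator_add (hb : KoszulExact b) (hC : A = C * skew b)
    (hg₀ : φ ᵥ* C = g₀ • b) {g : R} (hg : ∀ j, ∃ c : Fin 3 → R, φ ⬝ᵥ c = g * b j) :
    ∃ (h : R) (t : Fin 3 → R), g = h * g₀ + φ ⬝ᵥ t := by
  choose c hc using hg
  set C' : Matrix (Fin 3) (Fin 3) R := Matrix.of fun i j => c j i
  have hC' : φ ᵥ* C' = g • b := funext hc
  obtain ⟨D, hD⟩ := H.exists_matrix (M := C' * skew b) (by
    rw [← vecMul_vecMul, hC', smul_vecMul, self_vecMul_skew, smul_zero])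
  obtain ⟨h, hh⟩ := H.lift' (D *ᵥ b) (by
    rw [mulVec_mulVec, ← hD, ← mulVec_mulVec, skew_mulVec_self, mulVec_zero])
  obtain ⟨E, hE⟩ := hb.exists_matrix (M := D - h • (1 : Matrix (Fin 3) (Fin 3) R)) (by
    rw [sub_mulVec, hh, smul_mulVec, one_mulVec, sub_self])
  obtain ⟨t, ht⟩ := H.isPrimitive.exists_vecMulVec (M := C' - h • C - A * E) (by
    rw [Matrix.sub_mul, Matrix.sub_mul, Matrix.mul_assoc, ← hE, hD, Matrix.smul_mul, ← hC,
      Matrix.mul_sub, Matrix.mul_smul, Matrix.mul_one, sub_self])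
  refine ⟨h, t, ?_⟩
  obtain ⟨i, hi⟩ := H.isPrimitive.exists_ne_zero
  have key : φ ᵥ* (C' - h • C - A * E) = φ ᵥ* vecMulVec t b := by rw [ht]
  rw [vecMul_sub, vecMul_sub, vecMul_smul, hC', hg₀, ← vecMul_vecMul, H.vecMul_eq, zero_vecMul,
    sub_zero, vecMul_vecMulVec] at key
  have := congrFun key i
  simp at this
  refine mul_right_cancel₀ hi ?_
  linear_combination this

end IsSyzygyMatrix

end SyzygyMatrix

/-! ### Regularity of the last relation and the Hilbert–Burch relation -/

section Quotient

variable {R R' : Type*} [CommRing R] [IsDomain R] [CommRing R'] [IsDomain R'] 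

/-- Modulo `a 2` every relation between the two remaining coprime entries is a multiple of the
obvious one; lifting the multiplier leaves corrections divisible by `a 2`. -/
lemma koszulExact_of_quotient [UniqueFactorizationMonoid R'] {a : Fin 3 → R} (π : R →+* R')
    (hπ : Function.Surjective π) (ha0 : a 2 ≠ 0) (hker : ∀ p, π p = 0 ↔ a 2 ∣ p)
    (ha : IsPrimitive ![π (a 0), π (a 1)]) : KoszulExact a := by
  intro v hv
  simp only [dotProduct, Fin.sum_univ_three] at hv
  have h2 : π (a 2) = 0 := (hker _).2 dvd_rfl
  have hv' : π (v 0) * π (a 0) + π (v 1) * π (a 1) = 0 := by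
    simpa [h2] using congrArg π hv
  obtain ⟨t, ht⟩ := ha.exists_smul (w := ![- π (v 1), π (v 0)]) (by
    intro i j
    fin_cases i <;> fin_cases j <;> simp
    · linear_combination hv'
    · linear_combination -hv')
  obtain ⟨T, rfl⟩ := hπ t
  have ht0 := congrFun ht 0
  have ht1 := congrFun ht 1
  simp at ht0 ht1
  obtain ⟨s₁, hs₁⟩ := (hker (v 1 + T * a 0)).1 (by rw [map_add, map_mul, ← ht0]; ring)
  obtain ⟨s₀, hs₀⟩ := (hker (v 0 - T * a 1)).1 (by rw [map_sub, map_mul, ht1, sub_self])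
  have hv2 : s₀ * a 0 + s₁ * a 1 + v 2 = 0 := by
    refine (mul_eq_zero.mp ?_).resolve_left ha0
    linear_combination hv - a 0 * hs₀ - a 1 * hs₁
  refine ⟨![-s₁, s₀, -T], ?_⟩
  ext i
  fin_cases i <;> simp [skew, vecMul, dotProduct, Fin.sum_univ_three]
  · linear_combination hs₀
  · linear_combination hs₁
  · linear_combination hv2

end Quotient

section SyzygyMatrix

variable {R : Type*} [CommRing R] [IsDomain R]

lemma IsPrimitive.exists_cross_eq_smul [UniqueFactorizationMonoid R] {φ : Fin 3 → R}
    (hφ : IsPrimitive φ) {u v : Fin 3 → R}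
    (hu : φ ⬝ᵥ u = 0) (hv : φ ⬝ᵥ v = 0) : ∃ h : R, u ⨯₃ v = h • φ := by
  refine hφ.exists_smul fun i j => ?_
  simp only [dotProduct, Fin.sum_univ_three] at hu hv
  rw [cross_apply]
  fin_cases i <;> fin_cases j <;> simp <;> grind

namespace IsSyzygyMatrix

variable {φ b : Fin 3 → R} {A : Matrix (Fin 3) (Fin 3) R} (H : IsSyzygyMatrix φ A b)

include H

/-- If (`b 0`, `b 1`) ≡ P (B₀, B₁) modulo `b 2`, then `A` sends (B₀, B₁, 0) to a multiple of `b 2`.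
By exactness this vector is a multiple of `b` modulo `b 2`, which inverts P. -/
lemma isPrimitive_quotient {R' : Type*} [CommRing R'] [IsDomain R'] (π : R →+* R')
    (hπ : Function.Surjective π) (hb2 : b 2 ≠ 0) (hker : ∀ p, π p = 0 ↔ b 2 ∣ p)
    (hb1 : ¬ b 2 ∣ b 1) : IsPrimitive ![π (b 0), π (b 1)] := by
  intro p hp
  obtain ⟨q₀, hq₀⟩ := hp 0
  obtain ⟨q₁, hq₁⟩ := hp 1
  obtain ⟨P, rfl⟩ := hπ p
  obtain ⟨B₀, rfl⟩ := hπ q₀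
  obtain ⟨B₁, rfl⟩ := hπ q₁
  simp only [Matrix.cons_val_zero, Matrix.cons_val_one] at hq₀ hq₁
  obtain ⟨γ₀, h₀⟩ := (hker (b 0 - P * B₀)).1 (by rw [map_sub, map_mul, hq₀, sub_self])
  obtain ⟨γ₁, h₁⟩ := (hker (b 1 - P * B₁)).1 (by rw [map_sub, map_mul, hq₁, sub_self])
  have hb1' : π (b 1) ≠ 0 := fun h => hb1 ((hker _).1 h)
  rw [hq₁] at hb1'
  have hA : ∀ i, A i 0 * b 0 + A i 1 * b 1 + A i 2 * b 2 = 0 := fun i => by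
    simpa [mulVec, dotProduct, Fin.sum_univ_three] using congrFun H.mulVec_eq i
  have hy : ∀ i, b 2 ∣ A i 0 * B₀ + A i 1 * B₁ := by
    intro i
    have : π (P * (A i 0 * B₀ + A i 1 * B₁)) = 0 :=
      (hker _).2 ⟨-(A i 2 + γ₀ * A i 0 + γ₁ * A i 1), by
        linear_combination hA i - A i 0 * h₀ - A i 1 * h₁⟩
    rw [map_mul] at this
    exact (hker _).1 ((mul_eq_zero.mp this).resolve_left (left_ne_zero_of_mul hb1'))
  choose s hs using hy
  have hBs : A *ᵥ ![B₀, B₁, 0] = b 2 • s := by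
    ext i
    simp [mulVec, dotProduct, Fin.sum_univ_three, hs]
  obtain ⟨c, hc⟩ := H.lift s (by
    have : b 2 * (φ ⬝ᵥ s) = 0 := by
      rw [← smul_eq_mul, ← dotProduct_smul, ← hBs, dotProduct_mulVec, H.vecMul_eq, zero_dotProduct]
    exact (mul_eq_zero.mp this).resolve_left hb2)
  obtain ⟨w, hw⟩ := H.lift' (![B₀, B₁, 0] - b 2 • c) (by
    rw [mulVec_sub, hBs, mulVec_smul, hc, sub_self])
  have := congrArg π (congrFun hw 1)
  simp [(hker (b 2)).2 dvd_rfl, hq₁] at this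
  refine IsUnit.of_mul_eq_one (π w) (mul_right_cancel₀ (right_ne_zero_of_mul hb1') ?_)
  linear_combination -this

/-- Dividing the column by g would give another syzygy A c, so e_m - g c would be a multiple of `b`;
applying ε to its m-th entry yields 1 = 0. -/
lemma not_forall_dvd {K : Type*} [CommRing K] [Nontrivial K] (ε : R →+* K) (m : Fin 3)
    (hb : ε (b m) = 0) {g : R} (hg : ε g = 0) : ¬ ∀ i, g ∣ A i m := by
  intro h
  choose s hs using h
  obtain ⟨c, hc⟩ : ∃ c, g • s = g • A *ᵥ c := by
    by_cases hg0 : g = 0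
    · exact ⟨0, by simp [hg0]⟩
    · obtain ⟨c, hc⟩ := H.lift s (by
        have := congrFun H.vecMul_eq m
        have h1 : g * (φ ⬝ᵥ s) = 0 := by
          rw [← smul_eq_mul, ← dotProduct_smul]
          simpa [vecMul, hs, dotProduct] using this
        exact (mul_eq_zero.mp h1).resolve_left hg0)
      exact ⟨c, by rw [hc]⟩
  obtain ⟨w, hw⟩ := H.lift' (Pi.single m 1 - g • c) (by
    rw [mulVec_sub, mulVec_smul, ← hc, mulVec_single_one, sub_eq_zero]
    ext i
    simp [hs])
  simpa [hg, hb] using congrArg ε (congrFun hw m)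

variable [UniqueFactorizationMonoid R]

/-- The Hilbert--Burch relation: the maximal minors of the columns of `A` are the multiples of `φ`
by the entries of `b`, up to a common unit. -/
lemma exists_cross_col_eq (hφ : IsPrimitive φ) : ∃ u : R, IsUnit u ∧
    ∀ i, A.col (i + 1) ⨯₃ A.col (i + 2) = (u * b i) • φ := by
  have hcol : ∀ m, φ ⬝ᵥ A.col m = 0 := fun m => congrFun H.vecMul_eq m
  choose h hh using fun i : Fin 3 =>
    hφ.exists_cross_eq_smul (hcol (i + 1)) (hcol (i + 2))
  have hA : ∀ i, A i 0 * b 0 + A i 1 * b 1 + A i 2 * b 2 = 0 := fun i => by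
    simpa [mulVec, dotProduct, Fin.sum_univ_three] using congrFun H.mulVec_eq i
  have e := fun i j => congrFun (hh i) j
  simp only [cross_apply, Matrix.col_apply, Pi.smul_apply, smul_eq_mul] at e
  have e00 := e 0 0
  have e01 := e 0 1
  have e02 := e 0 2
  have e10 := e 1 0
  have e11 := e 1 1
  have e12 := e 1 2
  have e20 := e 2 0
  have e21 := e 2 1
  have e22 := e 2 2
  simp at e00 e01 e02 e10 e11 e12 e20 e21 e22
  obtain ⟨k, hk⟩ := hφ.exists_ne_zero
  obtain ⟨u, hu⟩ := H.isPrimitive.exists_smul (w := h) (by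
    have h01 : b 0 * h 1 = b 1 * h 0 := by
      refine mul_right_cancel₀ hk ?_
      fin_cases k <;> simp only [Fin.zero_eta, Fin.mk_one, Fin.reduceFinMk]
      · linear_combination A 1 2 * hA 2 - A 2 2 * hA 1 - b 0 * e10 + b 1 * e00
      · linear_combination A 2 2 * hA 0 - A 0 2 * hA 2 - b 0 * e11 + b 1 * e01
      · linear_combination A 0 2 * hA 1 - A 1 2 * hA 0 - b 0 * e12 + b 1 * e02
    have h02 : b 0 * h 2 = b 2 * h 0 := by
      refine mul_right_cancel₀ hk ?_
      fin_cases k <;> simp only [Fin.zero_eta, Fin.mk_one, Fin.reduceFinMk]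
      · linear_combination -A 1 1 * hA 2 + A 2 1 * hA 1 - b 0 * e20 + b 2 * e00
      · linear_combination -A 2 1 * hA 0 + A 0 1 * hA 2 - b 0 * e21 + b 2 * e01
      · linear_combination -A 0 1 * hA 1 + A 1 1 * hA 0 - b 0 * e22 + b 2 * e02
    have h12 : b 1 * h 2 = b 2 * h 1 := by
      refine mul_right_cancel₀ hk ?_
      fin_cases k <;> simp only [Fin.zero_eta, Fin.mk_one, Fin.reduceFinMk]
      · linear_combination A 1 0 * hA 2 - A 2 0 * hA 1 - b 1 * e20 + b 2 * e10
      · linear_combination A 2 0 * hA 0 - A 0 0 * hA 2 - b 1 * e21 + b 2 * e11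
      · linear_combination A 0 0 * hA 1 - A 1 0 * hA 0 - b 1 * e22 + b 2 * e12
    intro i j
    fin_cases i <;> fin_cases j <;> simp [h01, h02, h12])
  refine ⟨u, ?_, fun i => by rw [hh, hu]; rfl⟩
  -- To see that `u` is a unit, apply this to the Koszul syzygies φ × w and φ × z, whose cross
  -- product is det(φ, w, z) φ. Since `h` is `u` times `b`, `u` divides every such determinant, in
  -- particular every entry of φ.
  have hmul : ∀ c c' : Fin 3 → R, (A *ᵥ c) ⨯₃ (A *ᵥ c') = ((c ⨯₃ c') ⬝ᵥ h) • φ := by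
    intro c c'
    ext i
    simp only [cross_apply, mulVec, dotProduct, Fin.sum_univ_three, Pi.smul_apply, smul_eq_mul]
    fin_cases i <;> simp
    · linear_combination (c 1 * c' 2 - c 2 * c' 1) * e00 + (c 2 * c' 0 - c 0 * c' 2) * e10 +
        (c 0 * c' 1 - c 1 * c' 0) * e20
    · linear_combination (c 1 * c' 2 - c 2 * c' 1) * e01 + (c 2 * c' 0 - c 0 * c' 2) * e11 +
        (c 0 * c' 1 - c 1 * c' 0) * e21
    · linear_combination (c 1 * c' 2 - c 2 * c' 1) * e02 + (c 2 * c' 0 - c 0 * c' 2) * e12 +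
        (c 0 * c' 1 - c 1 * c' 0) * e22
  have hdvd : ∀ w z : Fin 3 → R, u ∣ φ ⬝ᵥ (w ⨯₃ z) := by
    intro w z
    obtain ⟨c, hc⟩ := H.lift (φ ⨯₃ w) (dot_self_cross φ w)
    obtain ⟨c', hc'⟩ := H.lift (φ ⨯₃ z) (dot_self_cross φ z)
    have h1 : (φ ⨯₃ w) ⨯₃ (φ ⨯₃ z) = (φ ⬝ᵥ (w ⨯₃ z)) • φ := by
      ext i
      simp only [cross_apply, dotProduct, Fin.sum_univ_three, Pi.smul_apply, smul_eq_mul]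
      fin_cases i <;> simp <;> ring
    rw [hc, hc', hmul, hu, dotProduct_smul] at h1
    have := congrFun h1 k
    simp only [Pi.smul_apply] at this
    exact ⟨_, (mul_right_cancel₀ hk this).symm⟩
  refine hφ u fun i => ?_
  fin_cases i
  · simpa [cross_apply, dotProduct, Fin.sum_univ_three] using hdvd ![0, 1, 0] ![0, 0, 1]
  · simpa [cross_apply, dotProduct, Fin.sum_univ_three] using hdvd ![0, 0, 1] ![1, 0, 0]
  · simpa [cross_apply, dotProduct, Fin.sum_univ_three] using hdvd ![1, 0, 0] ![0, 1, 0]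

/-- Otherwise `A i 0 * b 0`, hence `A i 0 * b m` for all m, would be divisible by `b 2`. Primitivity
would make the whole first column divisible by `b 2`. -/
lemma not_dvd {K : Type*} [CommRing K] [Nontrivial K] (ε : R →+* K)
    (hb : ∀ m, ε (b m) = 0) : ¬ b 2 ∣ b 1 := by
  intro h
  refine H.not_forall_dvd ε 0 (hb 0) (hb 2) fun i => H.isPrimitive.dvd _ _ fun m => ?_
  have hA : A i 0 * b 0 + A i 1 * b 1 + A i 2 * b 2 = 0 := by
    simpa [mulVec, dotProduct, Fin.sum_univ_three] using congrFun H.mulVec_eq i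
  fin_cases m
  · obtain ⟨t, ht⟩ := h
    exact ⟨- A i 1 * t - A i 2, by simp only [Fin.zero_eta]; linear_combination hA - A i 1 * ht⟩
  · exact h.mul_left _
  · exact dvd_mul_left _ _

lemma apply_two_ne_zero {K : Type*} [CommRing K] [Nontrivial K] (ε : R →+* K)
    (hb : ∀ m, ε (b m) = 0) : b 2 ≠ 0 := by
  intro h
  refine H.not_forall_dvd ε 0 (hb 0) (hb 1) fun i => H.isPrimitive.dvd _ _ fun m => ?_
  have hA : A i 0 * b 0 + A i 1 * b 1 + A i 2 * b 2 = 0 := by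
    simpa [mulVec, dotProduct, Fin.sum_univ_three] using congrFun H.mulVec_eq i
  fin_cases m
  · exact ⟨- A i 1, by simp only [Fin.zero_eta]; linear_combination hA - A i 2 * h⟩
  · exact dvd_mul_left _ _
  · simp [h]

end IsSyzygyMatrix

end SyzygyMatrix
open MvPolynomial

/-! ### Graded polynomial rings, linear sections and binary forms -/

section Graded

variable {σ k : Type*} [Field k]

/-- A polynomial that is zero or homogeneous of degree `m`, where `m` is an integer. -/
def IsIntHomogeneous (p : MvPolynomial σ k) (m : ℤ) : Prop :=
  p = 0 ∨ ∃ n : ℕ, (n : ℤ) = m ∧ p.IsHomogeneous n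

/-- The homogeneous component of integer degree, zero in negative degrees. -/
noncomputable def intComponent (m : ℤ) : MvPolynomial σ k →ₗ[k] MvPolynomial σ k :=
  if 0 ≤ m then homogeneousComponent m.toNat else 0

lemma intComponent_natCast (n : ℕ) :
    (intComponent n : MvPolynomial σ k →ₗ[k] _) = homogeneousComponent n := by
  simp [intComponent]

lemma intComponent_of_neg {m : ℤ} (hm : m < 0) (p : MvPolynomial σ k) : intComponent m p = 0 := by
  simp [intComponent, hm.not_ge]

lemma isIntHomogeneous_intComponent (m : ℤ) (p : MvPolynomial σ k) :
    IsIntHomogeneous (intComponent m p) m := by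
  rcases lt_or_ge m 0 with hm | hm
  · exact Or.inl (intComponent_of_neg hm p)
  · lift m to ℕ using hm
    rw [intComponent_natCast]
    exact Or.inr ⟨m, rfl, homogeneousComponent_isHomogeneous m p⟩

lemma _root_.MvPolynomial.IsHomogeneous.isIntHomogeneous {p : MvPolynomial σ k} {n : ℕ}
    (h : p.IsHomogeneous n) : IsIntHomogeneous p n := Or.inr ⟨n, rfl, h⟩

namespace IsIntHomogeneous

variable {p q : MvPolynomial σ k} {m l : ℤ}

lemma isHomogeneous {n : ℕ} (h : IsIntHomogeneous p n) : p.IsHomogeneous n := by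
  rcases h with rfl | ⟨n', h, h'⟩
  · exact isHomogeneous_zero _ _ _
  · rwa [Nat.cast_injective h] at h'

lemma nonneg (h : IsIntHomogeneous p m) (hp : p ≠ 0) : 0 ≤ m := by
  rcases h with rfl | ⟨n, rfl, -⟩
  · exact absurd rfl hp
  · exact Int.natCast_nonneg n

lemma unique (h : IsIntHomogeneous p m) (h' : IsIntHomogeneous p l) (hp : p ≠ 0) : m = l := by
  obtain ⟨n, rfl, hn⟩ := h.resolve_left hp
  obtain ⟨n', rfl, hn'⟩ := h'.resolve_left hp
  rw [hn.inj_right hn' hp]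

lemma intComponent_self (h : IsIntHomogeneous p m) : intComponent m p = p := by
  rcases h with rfl | ⟨n, rfl, h⟩
  · simp
  · rw [intComponent_natCast, homogeneousComponent_eq_self h]

lemma intComponent_mul (h : IsIntHomogeneous q l) (p : MvPolynomial σ k) (m : ℤ) :
    intComponent m (p * q) = intComponent (m - l) p * q := by
  classical
  rcases h with rfl | ⟨n, rfl, h⟩
  · simp
  rcases lt_or_ge m 0 with hm | hm
  · rw [intComponent_of_neg hm, intComponent_of_neg (by omega), zero_mul]
  lift m to ℕ using hm
  let _ := gradedAlgebra (σ := σ) (R := k)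
  have key := DirectSum.coe_decompose_mul_of_right_mem (homogeneousSubmodule σ k) (a := p) m h
  have hd : ∀ (r : MvPolynomial σ k) (i : ℕ),
      (DirectSum.decompose (homogeneousSubmodule σ k) r i : MvPolynomial σ k) =
        homogeneousComponent i r := fun r i => decomposition.decompose'_apply r i
  rw [hd, hd] at key
  rw [intComponent_natCast, key]
  split_ifs with hnm
  · rw [← intComponent_natCast, Nat.cast_sub hnm]
  · rw [intComponent_of_neg (by omega), zero_mul]

lemma mul (hp : IsIntHomogeneous p m) (hq : IsIntHomogeneous q l) :
    IsIntHomogeneous (p * q) (m + l) := by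
  rcases hp with rfl | ⟨n, rfl, hp⟩
  · exact Or.inl (zero_mul _)
  rcases hq with rfl | ⟨n', rfl, hq⟩
  · exact Or.inl (mul_zero _)
  · exact Or.inr ⟨n + n', by push_cast; rfl, hp.mul hq⟩

lemma sub (hp : IsIntHomogeneous p m) (hq : IsIntHomogeneous q m) :
    IsIntHomogeneous (p - q) m := by
  rw [← hp.intComponent_self, ← hq.intComponent_self, ← map_sub]
  exact isIntHomogeneous_intComponent _ _

end IsIntHomogeneous

lemma finrank_homogeneousSubmodule_fin_two (n : ℕ) :
    Module.finrank k (homogeneousSubmodule (Fin 2) k n) = n + 1 := by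
  let E : {d : Fin 2 →₀ ℕ | d.degree = n} ≃ Fin (n + 1) :=
    { toFun d := ⟨d.1 0, by
        have := d.2
        simp only [Set.mem_ofPred_eq, Finsupp.degree_eq_sum, Fin.sum_univ_two] at this
        omega⟩
      invFun i := ⟨Finsupp.equivFunOnFinite.symm ![i, n - i], by
        have := i.2
        simp only [Set.mem_ofPred_eq, Finsupp.degree_eq_sum, Fin.sum_univ_two]
        simp
        omega⟩
      left_inv d := by
        have := d.2
        simp only [Set.mem_ofPred_eq, Finsupp.degree_eq_sum, Fin.sum_univ_two] at this
        ext i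
        fin_cases i
        · simp
        · simp
          omega
      right_inv i := by simp }
  rw [homogeneousSubmodule_eq_finsupp_supported,
    (AddMonoidAlgebra.supportedEquivFinsupp _ |>.trans (Finsupp.domLCongr E)).finrank_eq]
  simp

lemma exists_eq_sum_smul_X {ℓ : MvPolynomial (Fin 3) k} (hℓ : ℓ.IsHomogeneous 1)
    (hℓ0 : ℓ ≠ 0) : ∃ (c : Fin 3 → k) (i : Fin 3), c i ≠ 0 ∧ ∑ j, c j • X j = ℓ := by
  have hmem : ℓ ∈ Submodule.span k (Set.range (X : Fin 3 → MvPolynomial (Fin 3) k)) := by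
    rw [← homogeneousSubmodule_one_eq_span_X]; exact hℓ
  obtain ⟨c, hc⟩ := (Submodule.mem_span_range_iff_exists_fun k).1 hmem
  by_contra! h
  refine hℓ0 ?_
  rw [← hc]
  exact Finset.sum_eq_zero fun i _ => by
    rw [of_not_not fun hi => h c i hi hc, zero_smul]

/-- The quotient of a polynomial ring in three variables by a linear form is a polynomial ring in
two variables. -/
lemma exists_quotient_by_linear_form {ℓ : MvPolynomial (Fin 3) k} {c : Fin 3 → k} {i : Fin 3}
    (hi : c i ≠ 0) (hc : ∑ j, c j • X j = ℓ) :
    ∃ (π : MvPolynomial (Fin 3) k →ₐ[k] MvPolynomial (Fin 2) k)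
      (s : MvPolynomial (Fin 2) k →ₐ[k] MvPolynomial (Fin 3) k),
      (∀ p, π (s p) = p) ∧ (∀ p, π p = 0 ↔ ℓ ∣ p) ∧ (∀ p, ℓ ∣ p - s (π p)) ∧
      (∀ p n, p.IsHomogeneous n → (π p).IsHomogeneous n) ∧
      (∀ p n, p.IsHomogeneous n → (s p).IsHomogeneous n) ∧
      ∀ j, π (X (i.succAbove j)) = X j := by
  rw [Fin.sum_univ_succAbove _ i] at hc
  let y : MvPolynomial (Fin 2) k := ∑ j, C (-(c i)⁻¹ * c (i.succAbove j)) * X j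
  let v : Fin 3 → MvPolynomial (Fin 2) k := Fin.insertNth i y X
  let π : MvPolynomial (Fin 3) k →ₐ[k] MvPolynomial (Fin 2) k := aeval v
  let s : MvPolynomial (Fin 2) k →ₐ[k] MvPolynomial (Fin 3) k := aeval fun j => X (i.succAbove j)
  have hvi : v i = y := Fin.insertNth_apply_same ..
  have hvj : ∀ j, v (i.succAbove j) = X j := fun j => Fin.insertNth_apply_succAbove ..
  have hπs : ∀ p, π (s p) = p := fun p => by
    have : π.comp s = AlgHom.id k _ := by
      ext j : 1
      simp [π, s, hvj]
    exact DFunLike.congr_fun this p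
  have hπℓ : π ℓ = 0 := by
    rw [← hc]
    have h1 : (C (c i) : MvPolynomial (Fin 2) k) * C (c i)⁻¹ = 1 := by
      rw [← C_mul, mul_inv_cancel₀ hi, C_1]
    simp only [map_add, map_mul, algHom_C, algebraMap_eq, π, aeval_X, hvi, hvj, y, smul_eq_C_mul,
      Fin.sum_univ_two, neg_mul, C_neg]
    linear_combination (-C (c (i.succAbove 0)) * X 0 - C (c (i.succAbove 1)) * X 1) * h1
  have hdiv : ∀ p, ℓ ∣ p - s (π p) := fun p => by
    have : (Ideal.Quotient.mkₐ k (Ideal.span {ℓ})).comp (s.comp π) =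
        Ideal.Quotient.mkₐ k (Ideal.span {ℓ}) := by
      ext j : 1
      simp only [AlgHom.comp_apply, Ideal.Quotient.mkₐ_eq_mk]
      rw [Ideal.Quotient.mk_eq_mk_iff_sub_mem, Ideal.mem_span_singleton]
      refine i.succAboveCases ?_ (fun j => ?_) j
      · refine ⟨-C (c i)⁻¹, ?_⟩
        rw [← hc]
        simp only [π, aeval_X, hvi, y, map_add, map_mul, s, algHom_C, smul_eq_C_mul, neg_mul,
          Fin.sum_univ_two, map_neg, algebraMap_eq]
        have h1 : (C (c i) : MvPolynomial (Fin 3) k) * C (c i)⁻¹ = 1 := by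
          rw [← C_mul, mul_inv_cancel₀ hi, C_1]
        linear_combination X i * h1
      · simp [π, s, hvj]
    rw [← Ideal.mem_span_singleton, ← Ideal.Quotient.mk_eq_mk_iff_sub_mem]
    exact (DFunLike.congr_fun this p).symm
  refine ⟨π, s, hπs, fun p => ⟨fun hp => ?_, ?_⟩, hdiv, fun p n hp => ?_, fun p n hp => ?_,
    fun j => by simp only [π, aeval_X, hvj]⟩
  · simpa [hp] using hdiv p
  · rintro ⟨q, rfl⟩
    rw [map_mul, hπℓ, zero_mul]
  · rw [← one_mul n]
    refine hp.aeval v fun j => ?_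
    refine i.succAboveCases ?_ (fun j => ?_) j
    · rw [hvi]
      exact IsHomogeneous.sum _ _ _ fun j _ => isHomogeneous_C_mul_X _ _
    · rw [hvj]
      exact isHomogeneous_X _ _
  · rw [← one_mul n]
    exact hp.aeval _ fun j => isHomogeneous_X _ _

lemma koszulExact_X_pow (n : ℕ) :
    KoszulExact ![(X 0 : MvPolynomial (Fin 3) k) ^ n, X 1 ^ n, X 2 ^ n] := by
  refine KoszulExact.pow ?_ n
  obtain ⟨π, s, hπs, hker, -, -, -, hX⟩ := exists_quotient_by_linear_form (ℓ := X (2 : Fin 3))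
    (c := Pi.single 2 (1 : k)) (i := 2) (by simp) (by simp [Pi.single_apply])
  refine koszulExact_of_quotient π.toRingHom (fun p => ⟨s p, hπs p⟩) (X_ne_zero 2) hker ?_
  have h0 : π (X 0) = X 0 := hX 0
  have h1 : π (X 1) = X 1 := hX 1
  intro p hp
  have h : IsRelPrime (X 0 : MvPolynomial (Fin 2) k) (X 1) := by
    rw [(X_prime (i := (0 : Fin 2))).irreducible.isRelPrime_iff_not_dvd, X_dvd_X]
    decide
  exact h (by simpa [h0] using hp 0) (by simpa [h1] using hp 1)

lemma isPrimitive_X_pow (n : ℕ) :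
    IsPrimitive ![(X 0 : MvPolynomial (Fin 3) k) ^ n, X 1 ^ n, X 2 ^ n] := by
  intro p hp
  have h : IsRelPrime (X 0 : MvPolynomial (Fin 3) k) (X 1) := by
    rw [(X_prime (i := (0 : Fin 3))).irreducible.isRelPrime_iff_not_dvd, X_dvd_X]
    decide
  exact h.pow (by simpa using hp 0) (by simpa using hp 1)

/-- Derivatives have smaller degree, so they all vanish; in characteristic zero `p` is then
constant. -/
lemma isUnit_of_dvd_pderiv [CharZero k] {p : MvPolynomial σ k} (hp0 : p ≠ 0)
    (h : ∀ i, p ∣ pderiv i p) : IsUnit p := by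
  have hz : ∀ i, pderiv i p = 0 := by
    intro i
    by_contra hne
    obtain ⟨q, hq⟩ := h i
    have hq0 : q ≠ 0 := by
      rintro rfl
      exact hne (by rw [hq, mul_zero])
    have hdeg := totalDegree_mul_of_isDomain hp0 hq0
    rw [← hq] at hdeg
    obtain ⟨m, hm, hm'⟩ := Finset.exists_mem_eq_sup (pderiv i p).support (support_nonempty.2 hne)
      (fun s => s.sum fun _ e => e)
    rw [mem_support_iff, coeff_pderiv] at hm
    have := le_totalDegree (mem_support_iff.2 (left_ne_zero_of_mul hm))
    rw [Finsupp.sum_add_index' (by simp) (by simp), Finsupp.sum_single_index rfl] at this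
    have h2 : (pderiv i p).totalDegree = m.sum fun _ e => e := hm'
    omega
  have hC : p = C (coeff 0 p) := by
    classical
    ext m
    rw [coeff_C]
    split_ifs with hm
    · rw [hm]
    · obtain ⟨i, hi⟩ := Finsupp.ne_iff.1 (Ne.symm hm)
      have := congrArg (coeff (m - Finsupp.single i 1)) (hz i)
      rw [coeff_pderiv, tsub_add_cancel_of_le
        (Finsupp.single_le_iff.2 (Nat.one_le_iff_ne_zero.2 hi)), coeff_zero] at this
      exact (mul_eq_zero.1 this).resolve_right (Nat.cast_add_one_ne_zero _)
  rw [hC]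
  exact (IsUnit.mk0 _ fun h0 => hp0 (by rw [hC, h0, C_0])).map C

/-- The partial derivatives of a squarefree homogeneous polynomial have no common factor. -/
lemma isPrimitive_pderiv [CharZero k] [Fintype σ] {f : MvPolynomial σ k} {d : ℕ} (hd : d ≠ 0)
    (hf : f.IsHomogeneous d) (hsq : Squarefree f) : IsPrimitive fun i => pderiv i f := by
  intro p hp
  by_contra hpu
  have hf0 : f ≠ 0 := hsq.ne_zero
  have hdk : (C (d : k) : MvPolynomial σ k) * C ((d : k)⁻¹) = 1 := by
    rw [← C_mul, mul_inv_cancel₀ (Nat.cast_ne_zero.2 hd), C_1]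
  have heuler := hf.sum_X_mul_pderiv
  rw [nsmul_eq_mul, ← map_natCast (C : k →+* MvPolynomial σ k)] at heuler
  have hdvd : ∀ q, (∀ i, q ∣ pderiv i f) → q ∣ f := by
    intro q hq
    have : q ∣ C (d : k) * f := heuler ▸ Finset.dvd_sum fun i _ => (hq i).mul_left _
    have h2 : f = C ((d : k)⁻¹) * (C (d : k) * f) := by
      rw [← mul_assoc, mul_comm (C _), hdk, one_mul]
    rw [h2]
    exact this.mul_left _
  have hp0 : p ≠ 0 := by
    rintro rfl
    exact hf0 (zero_dvd_iff.1 (hdvd 0 hp))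
  obtain ⟨r, hr, hrp⟩ := WfDvdMonoid.exists_irreducible_factor hpu hp0
  have hr' := UniqueFactorizationMonoid.irreducible_iff_prime.1 hr
  obtain ⟨g, rfl⟩ := hdvd r fun i => hrp.trans (hp i)
  refine hr.not_isUnit (isUnit_of_dvd_pderiv hr.ne_zero fun i => ?_)
  have h1 : r ∣ pderiv i (r * g) := hrp.trans (hp i)
  rw [Derivation.leibniz, smul_eq_mul, smul_eq_mul] at h1
  -- Modulo `r` only `g` times the derivative of `r` survives, and squarefreeness keeps `r` from
  -- dividing `g`.
  have h2 := (dvd_add_right (dvd_mul_right r _)).1 h1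
  refine (hr'.dvd_or_dvd h2).resolve_left fun hg => ?_
  exact hr.not_isUnit (hsq r (mul_dvd_mul_left r hg))

instance [Finite σ] (n : ℕ) : Module.Finite k (homogeneousSubmodule σ k n) :=
  Module.Finite.iff_fg.2 (homogeneousSubmodule_fg σ k n)

/-- Multiplication by a homogeneous polynomial, as a map between graded pieces. -/
noncomputable def mulHomogeneous {q : MvPolynomial σ k} {n i j : ℕ} (hq : q.IsHomogeneous n)
    (h : i + n = j) : homogeneousSubmodule σ k i →ₗ[k] homogeneousSubmodule σ k j :=
  ((LinearMap.mulRight k q).comp (Submodule.subtype _)).codRestrict _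
    fun p => h ▸ IsHomogeneous.mul p.2 hq

@[simp]
lemma coe_mulHomogeneous {q : MvPolynomial σ k} {n i j : ℕ} (hq : q.IsHomogeneous n)
    (h : i + n = j) (p : homogeneousSubmodule σ k i) :
    (mulHomogeneous hq h p : MvPolynomial σ k) = p * q := rfl

/-- Coprime binary forms generate all forms of large degree. -/
lemma IsPrimitive.exists_eq_add_of_isHomogeneous {b₀ b₁ : MvPolynomial (Fin 2) k} {n₀ n₁ : ℕ}
    (hb : IsPrimitive ![b₀, b₁]) (h₀ : b₀.IsHomogeneous n₀) (h₁ : b₁.IsHomogeneous n₁) {j : ℕ}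
    {p : MvPolynomial (Fin 2) k} (hp : p.IsHomogeneous (j + n₀ + n₁)) :
    ∃ x y, p = x * b₀ + y * b₁ := by
  -- Dimension count: the kernel of `T` consists of Koszul relations, so has dimension at most j +
  -- 1, and (j + n₁ + 1) + (j + n₀ + 1) - (j + 1) is the dimension of the target.
  let T := (mulHomogeneous h₀ (show j + n₁ + n₀ = j + n₀ + n₁ by ring)).coprod
    (mulHomogeneous h₁ (show j + n₀ + n₁ = j + n₀ + n₁ from rfl))
  let D := (mulHomogeneous h₁ (show j + n₁ = j + n₁ from rfl)).prod
    (-mulHomogeneous h₀ (show j + n₀ = j + n₀ from rfl))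
  have hker : LinearMap.ker T ≤ LinearMap.range D := by
    rintro ⟨x, y⟩ hxy
    have hxy' : (x : MvPolynomial (Fin 2) k) * b₀ + y * b₁ = 0 := congrArg Subtype.val hxy
    obtain ⟨t, ht⟩ := hb.exists_smul (w := ![- (y : MvPolynomial (Fin 2) k), x]) (by
      intro i j
      fin_cases i <;> fin_cases j <;> simp
      · linear_combination hxy'
      · linear_combination -hxy')
    have ht0 := congrArg (intComponent ((j + n₀ : ℕ) : ℤ)) (congrFun ht 0)
    have ht1 := congrArg (intComponent ((j + n₁ : ℕ) : ℤ)) (congrFun ht 1)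
    have hx := (IsHomogeneous.isIntHomogeneous x.2).intComponent_self
    have hy := (IsHomogeneous.isIntHomogeneous y.2).intComponent_self
    simp [h₀.isIntHomogeneous.intComponent_mul, h₁.isIntHomogeneous.intComponent_mul] at ht0 ht1
    push_cast at hx hy
    rw [hy, intComponent_natCast] at ht0
    rw [hx, intComponent_natCast] at ht1
    refine ⟨⟨homogeneousComponent j t, homogeneousComponent_isHomogeneous j t⟩, ?_⟩
    refine Prod.ext (Subtype.ext ?_) (Subtype.ext ?_)
    · exact ht1.symm
    · simp [D, ← ht0]
  have h1 : Module.finrank k (LinearMap.ker T) ≤ j + 1 := by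
    refine (Submodule.finrank_mono hker).trans ((LinearMap.finrank_range_le D).trans ?_)
    rw [finrank_homogeneousSubmodule_fin_two]
  have h2 := LinearMap.finrank_range_add_finrank_ker T
  rw [Module.finrank_prod, finrank_homogeneousSubmodule_fin_two,
    finrank_homogeneousSubmodule_fin_two] at h2
  have h3 : LinearMap.range T = ⊤ := by
    refine Submodule.eq_top_of_finrank_eq (le_antisymm (Submodule.finrank_le _) ?_)
    rw [finrank_homogeneousSubmodule_fin_two]
    omega
  obtain ⟨⟨x, y⟩, hxy⟩ := LinearMap.range_eq_top.1 h3 ⟨p, hp⟩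
  exact ⟨x, y, (congrArg Subtype.val hxy).symm⟩

/-- The factor `C` of `A` and the generator `g₀` can be chosen homogeneous. -/
lemma IsSyzygyMatrix.exists_homogeneous_generator {φ b : Fin 3 → MvPolynomial σ k}
    {A : Matrix (Fin 3) (Fin 3) (MvPolynomial σ k)} (H : IsSyzygyMatrix φ A b)
    (hb : KoszulExact b) {δ κ : ℤ} {α β : Fin 3 → ℤ} (hφ : ∀ i, IsIntHomogeneous (φ i) δ)
    (hA : ∀ i j, IsIntHomogeneous (A i j) (α j)) (hβ : ∀ i, IsIntHomogeneous (b i) (β i))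
    (hα : ∀ j, α j = β (j + 1) + β (j + 2) + κ) :
    ∃ (C : Matrix (Fin 3) (Fin 3) (MvPolynomial σ k)) (g₀ : MvPolynomial σ k),
      A = C * skew b ∧ φ ᵥ* C = g₀ • b ∧ IsIntHomogeneous g₀ (δ + κ) := by
  obtain ⟨C, g₀, hC, hg⟩ := H.exists_generator hb
  -- Both identities survive passing to the component of the degree prescribed by the grading.
  refine ⟨Matrix.of fun i j => intComponent (β j + κ) (C i j), intComponent (δ + κ) g₀, ?_, ?_,
    isIntHomogeneous_intComponent _ _⟩
  · ext1 i j
    have h := congrArg (intComponent (α j)) (congrFun (congrFun hC i) j)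
    rw [(hA i j).intComponent_self] at h
    rw [h, hα]
    simp only [Matrix.mul_apply, Fin.sum_univ_three, map_add, skew, Matrix.of_apply]
    fin_cases j <;> simp [(hβ _).intComponent_mul] <;> ring_nf
  · ext1 j
    have h := congrArg (intComponent (δ + κ + β j)) (congrFun hg j)
    simp only [Pi.smul_apply, smul_eq_mul, (hβ _).intComponent_mul, vecMul, dotProduct, map_sum]
      at h ⊢
    rw [add_sub_cancel_right] at h
    rw [← h]
    refine Finset.sum_congr rfl fun i _ => ?_
    rw [mul_comm (φ i), mul_comm (φ i), (hφ i).intComponent_mul, Matrix.of_apply]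
    congr 2
    ring_nf

end Graded

/-! ### The Jacobian ideal and its saturation -/

section Jacobian

lemma mem_jacobianIdeal {f g : S} :
    g ∈ jacobianIdeal f ↔ ∃ t : Fin 3 → S, (fun i => pderiv i f) ⬝ᵥ t = g := by
  rw [jacobianIdeal, Ideal.mem_span_range_iff_exists_fun]
  simp only [dotProduct, mul_comm]

lemma intComponent_mem_jacobianIdeal {f g : S} {d : ℕ} (hf : f.IsHomogeneous d)
    (hg : g ∈ jacobianIdeal f) (m : ℤ) : intComponent m g ∈ jacobianIdeal f := by
  obtain ⟨t, rfl⟩ := mem_jacobianIdeal.1 hg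
  simp only [dotProduct, map_sum]
  refine Ideal.sum_mem _ fun i _ => ?_
  rw [mul_comm, (hf.pderiv (i := i)).isIntHomogeneous.intComponent_mul]
  exact Ideal.mul_mem_left _ _ (Ideal.subset_span ⟨i, rfl⟩)

lemma jacobianMap_apply (f : S) (v : Fin 3 → S) :
    jacobianMap f v = (fun i => pderiv i f) ⬝ᵥ v := by
  simp [jacobianMap, dotProduct, mul_comm]

lemma isSyzygyMatrix_of_exact {f : S} {A : Matrix (Fin 3) (Fin 3) S}
    {B : Matrix (Fin 3) (Fin 1) S}
    (h₁ : LinearMap.ker (jacobianMap f) = LinearMap.range A.mulVecLin)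
    (h₂ : LinearMap.ker A.mulVecLin = LinearMap.range B.mulVecLin)
    (h₃ : LinearMap.ker B.mulVecLin = ⊥) :
    IsSyzygyMatrix (fun i => pderiv i f) A fun i => B i 0 := by
  have hB : ∀ s : Fin 1 → S, B *ᵥ s = s 0 • fun i => B i 0 := by
    intro s
    ext1 i
    simp [mulVec, dotProduct, mul_comm]
  refine ⟨?_, ?_, fun v hv => ?_, fun v hv => ?_, fun h => ?_⟩
  · ext1 j
    have : A *ᵥ Pi.single j 1 ∈ LinearMap.ker (jacobianMap f) := h₁ ▸ ⟨_, rfl⟩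
    rw [LinearMap.mem_ker, jacobianMap_apply, dotProduct_mulVec, dotProduct_single, mul_one] at this
    exact this
  · have : B *ᵥ 1 ∈ LinearMap.ker A.mulVecLin := h₂ ▸ ⟨1, rfl⟩
    rw [hB, Pi.one_apply, one_smul] at this
    exact this
  · obtain ⟨c, hc⟩ : v ∈ LinearMap.range A.mulVecLin := by
      rwa [← h₁, LinearMap.mem_ker, jacobianMap_apply]
    exact ⟨c, hc.symm⟩
  · obtain ⟨s, hs⟩ : v ∈ LinearMap.range B.mulVecLin := by
      rwa [← h₂]
    exact ⟨s 0, by rw [← hs, mulVecLin_apply, hB]⟩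
  · have : (1 : Fin 1 → S) ∈ LinearMap.ker B.mulVecLin := by
      rw [LinearMap.mem_ker, mulVecLin_apply, hB, h, smul_zero]
    rw [h₃] at this
    simpa using congrFun ((Submodule.mem_bot S).1 this) 0

lemma irrelevantIdeal_pow_le {I : Ideal S} {n : ℕ} (hI : ∀ p : S, p.IsHomogeneous n → p ∈ I) :
    irrelevantIdeal ^ n ≤ I := by
  intro p hp
  obtain ⟨q, hq, rfl⟩ := (Ideal.mem_span_pow_iff_exists_isHomogeneous _ _).1 hp
  rw [eval_eq']
  refine Ideal.sum_mem _ fun m hm => Ideal.mul_mem_left _ _ (hI _ ?_)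
  have : m.degree = n := by
    by_contra h
    exact (mem_support_iff.1 hm) (hq.coeff_eq_zero h)
  have h2 := isHomogeneous_monomial (1 : ℂ) this
  rwa [monomial_eq, C_1, one_mul, Finsupp.prod_fintype _ _ (by simp)] at h2

/-- Some power n puts `X i ^ n * g` in J_f. The sequence of n-th powers is Koszul exact and
primitive, so `b j * g` lies in J_f too, and g₀ accounts for all such g. -/
lemma exists_eq_mul_of_mem_saturation {f g₀ : S} {b : Fin 3 → S} {A C : Matrix (Fin 3) (Fin 3) S}
    (H : IsSyzygyMatrix (fun i => pderiv i f) A b) (hb : KoszulExact b) (hC : A = C * skew b)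
    (hg₀ : (fun i => pderiv i f) ᵥ* C = g₀ • b) {g : S} (hg : g ∈ saturation (jacobianIdeal f)) :
    ∃ h, g - h * g₀ ∈ jacobianIdeal f := by
  obtain ⟨n, hn⟩ := hg
  obtain ⟨h, t, ht⟩ := H.exists_eq_mul_generator_add hb hC hg₀ fun j =>
    H.mul_mem_of_koszulExact (koszulExact_X_pow n) (isPrimitive_X_pow n) (fun i => by
      have hX : (![X 0 ^ n, X 1 ^ n, X 2 ^ n] : Fin 3 → S) i ∈ irrelevantIdeal ^ n := by
        fin_cases i <;> exact Ideal.pow_mem_pow (Ideal.subset_span (Set.mem_range_self _)) n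
      exact mem_jacobianIdeal.1 (mul_comm g _ ▸ hn _ hX)) j
  exact ⟨h, mem_jacobianIdeal.2 ⟨t, by rw [ht]; ring⟩⟩

end Jacobian

/-! ### Hilbert function of N(f) -/

section Defect

lemma dimN_eq_zero_of_lt {f g₀ : S} {d k₀ k : ℕ} (hf : f.IsHomogeneous d)
    (hsat : ∀ g ∈ saturation (jacobianIdeal f), ∃ h, g - h * g₀ ∈ jacobianIdeal f)
    (hg₀ : g₀.IsHomogeneous k₀) (hk : k < k₀) : dimN f k = 0 := by
  rw [dimN]
  have : Subsingleton (degreePart (saturation (jacobianIdeal f)) k ⧸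
      (degreePart (jacobianIdeal f) k).comap
        (degreePart (saturation (jacobianIdeal f)) k).subtype) := by
    rw [Submodule.Quotient.subsingleton_iff, eq_top_iff]
    rintro ⟨g, hg, hgk⟩ -
    obtain ⟨h, hh⟩ := hsat g hg
    have := intComponent_mem_jacobianIdeal hf hh k
    rw [map_sub, (IsHomogeneous.isIntHomogeneous hgk).intComponent_self,
      hg₀.isIntHomogeneous.intComponent_mul, intComponent_of_neg (by omega), zero_mul,
      sub_zero] at this
    exact ⟨this, hgk⟩
  exact Module.finrank_zero_of_subsingleton

/-- The map from binary forms to `N(f)` given by multiplication with a generator of `N(f)`. -/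
noncomputable def generatorMap {f g₀ : S} {k₀ j : ℕ} (hg : g₀ ∈ saturation (jacobianIdeal f))
    (hg₀ : g₀.IsHomogeneous k₀) {s : MvPolynomial (Fin 2) ℂ →ₐ[ℂ] S}
    (hs : ∀ p n, p.IsHomogeneous n → (s p).IsHomogeneous n) :
    homogeneousSubmodule (Fin 2) ℂ j →ₗ[ℂ] (degreePart (saturation (jacobianIdeal f)) (j + k₀) ⧸
      (degreePart (jacobianIdeal f) (j + k₀)).comap
        (degreePart (saturation (jacobianIdeal f)) (j + k₀)).subtype) :=
  (Submodule.mkQ _).comp <|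
    ((LinearMap.mulRight ℂ g₀).comp (s.toLinearMap.comp (Submodule.subtype _))).codRestrict _
      fun p => ⟨Ideal.mul_mem_left _ _ hg, (hs _ _ p.2).mul hg₀⟩

section GeneratorMap

variable {f g₀ : S} {k₀ j : ℕ} (hg : g₀ ∈ saturation (jacobianIdeal f))
    (hg₀ : g₀.IsHomogeneous k₀) {s : MvPolynomial (Fin 2) ℂ →ₐ[ℂ] S}
    (hs : ∀ p n, p.IsHomogeneous n → (s p).IsHomogeneous n)

lemma mem_ker_generatorMap {p : homogeneousSubmodule (Fin 2) ℂ j} :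
    p ∈ LinearMap.ker (generatorMap hg hg₀ hs) ↔ s p * g₀ ∈ jacobianIdeal f := by
  rw [LinearMap.mem_ker, generatorMap, LinearMap.comp_apply, Submodule.mkQ_apply,
    Submodule.Quotient.mk_eq_zero]
  exact ⟨fun h => h.1, fun h => ⟨h, (hs _ _ p.2).mul hg₀⟩⟩

/-- As ℓ kills g₀ modulo J_f, a multiplier of g₀ matters only modulo ℓ, where it is a binary form.
-/
lemma generatorMap_surjective {d : ℕ} (hf : f.IsHomogeneous d)
    (hsat : ∀ g ∈ saturation (jacobianIdeal f), ∃ h, g - h * g₀ ∈ jacobianIdeal f)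
    {ℓ : S} (hℓ : ℓ * g₀ ∈ jacobianIdeal f) {π : S →ₐ[ℂ] MvPolynomial (Fin 2) ℂ}
    (hπ : ∀ p n, p.IsHomogeneous n → (π p).IsHomogeneous n) (hπs : ∀ p, ℓ ∣ p - s (π p)) :
    Function.Surjective (generatorMap (j := j) hg hg₀ hs) := by
  intro x
  obtain ⟨⟨g, hg1, hgk⟩, rfl⟩ := Submodule.mkQ_surjective _ x
  obtain ⟨h, hh⟩ := hsat g hg1
  have h1 := intComponent_mem_jacobianIdeal hf hh ((j + k₀ : ℕ) : ℤ)
  rw [map_sub, (IsHomogeneous.isIntHomogeneous hgk).intComponent_self,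
    hg₀.isIntHomogeneous.intComponent_mul, Nat.cast_add, add_sub_cancel_right,
    intComponent_natCast] at h1
  set h' := homogeneousComponent j h
  refine ⟨⟨π h', hπ _ _ (homogeneousComponent_isHomogeneous j h)⟩, ?_⟩
  rw [generatorMap, LinearMap.comp_apply, ← sub_eq_zero, ← map_sub, Submodule.mkQ_apply,
    Submodule.Quotient.mk_eq_zero]
  refine ⟨?_, Submodule.sub_mem _ ((hs _ _ (hπ _ _
    (homogeneousComponent_isHomogeneous j h))).mul hg₀) hgk⟩
  obtain ⟨q, hq⟩ := hπs h'
  have h2 : s (π h') * g₀ - g = -(g - h' * g₀) - q * (ℓ * g₀) := by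
    linear_combination -g₀ * hq
  change s (π h') * g₀ - g ∈ jacobianIdeal f
  rw [h2]
  exact sub_mem (neg_mem h1) (Ideal.mul_mem_left _ _ hℓ)

end GeneratorMap

/-- If `N(f)` is generated by `g₀` with annihilator `(b₀, b₁, ℓ)`, where `ℓ` is a linear form and
`deg b₁ ≤ deg b₀`, then the defect of `f` is `deg b₁`. -/
lemma isGreatest_dimN {f g₀ ℓ b₀ b₁ : S} {d k₀ p q : ℕ} (hf : f.IsHomogeneous d)
    (hsat : ∀ g ∈ saturation (jacobianIdeal f), ∃ h, g - h * g₀ ∈ jacobianIdeal f)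
    (hg : g₀ ∈ saturation (jacobianIdeal f)) (hg₀ : g₀.IsHomogeneous k₀)
    {π : S →ₐ[ℂ] MvPolynomial (Fin 2) ℂ} {s : MvPolynomial (Fin 2) ℂ →ₐ[ℂ] S}
    (hs : ∀ p n, p.IsHomogeneous n → (s p).IsHomogeneous n)
    (hπ : ∀ p n, p.IsHomogeneous n → (π p).IsHomogeneous n) (hπs : ∀ p, π (s p) = p)
    (hsπ : ∀ p, ℓ ∣ p - s (π p)) (hπℓ : π ℓ = 0)
    (hℓ : ℓ * g₀ ∈ jacobianIdeal f) (hb₁ : b₁ * g₀ ∈ jacobianIdeal f) (hb₁0 : π b₁ ≠ 0)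
    (hann : ∀ h, h * g₀ ∈ jacobianIdeal f → ∃ x y z, h = x * b₀ + y * b₁ + z * ℓ)
    (h₀ : b₀.IsHomogeneous p) (h₁ : b₁.IsHomogeneous q) (hq : 1 ≤ q) (hqp : q ≤ p) :
    IsGreatest (Set.range (dimN f)) q := by
  have hdim : ∀ j, dimN f (j + k₀) + Module.finrank ℂ
      (LinearMap.ker (generatorMap (j := j) hg hg₀ hs)) = j + 1 := by
    intro j
    have h := LinearMap.finrank_range_add_finrank_ker (generatorMap (j := j) hg hg₀ hs)
    rwa [finrank_homogeneousSubmodule_fin_two, LinearMap.range_eq_top.2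
      (generatorMap_surjective hg hg₀ hs hf hsat hℓ hπ hsπ), finrank_top] at h
  constructor
  -- The maximum is attained in the last degree below those of `b₀` and `b₁`, where nothing is
  -- killed.
  · refine ⟨q - 1 + k₀, ?_⟩
    have h := hdim (q - 1)
    have hker : LinearMap.ker (generatorMap (j := q - 1) hg hg₀ hs) = ⊥ := by
      rw [eq_bot_iff]
      intro r hr
      rw [mem_ker_generatorMap] at hr
      obtain ⟨x, y, z, hxyz⟩ := hann _ hr
      have h1 := congrArg (fun r => intComponent ((q - 1 : ℕ) : ℤ) (π r)) hxyz
      simp only [hπs, map_add, map_mul, hπℓ, mul_zero, add_zero,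
        (hπ _ _ h₀).isIntHomogeneous.intComponent_mul,
        (hπ _ _ h₁).isIntHomogeneous.intComponent_mul] at h1
      rw [intComponent_of_neg (m := _ - (p : ℤ)) (by omega),
        intComponent_of_neg (m := _ - (q : ℤ)) (by omega), zero_mul, zero_mul,
        add_zero, (IsHomogeneous.isIntHomogeneous r.2).intComponent_self] at h1
      exact Subtype.ext h1
    rw [hker, finrank_bot] at h
    omega
  · rintro _ ⟨k, rfl⟩
    rcases lt_or_ge k k₀ with hk | hk
    · rw [dimN_eq_zero_of_lt hf hsat hg₀ hk]
      exact Nat.zero_le _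
    obtain ⟨j, rfl⟩ := Nat.exists_eq_add_of_le' hk
    have h := hdim j
    rcases lt_or_ge j q with hj | hj
    · omega
    obtain ⟨i, rfl⟩ := Nat.exists_eq_add_of_le' hj
    have hπb := hπ _ _ h₁
    -- Multiples of `b₁` contribute i + 1 dimensions to the kernel, leaving at most (i + q + 1) - (i
    -- + 1) = q.
    let M := (mulHomogeneous hπb (rfl : i + q = i + q)).codRestrict
      (LinearMap.ker (generatorMap (j := i + q) hg hg₀ hs)) (by
        intro r
        rw [mem_ker_generatorMap, coe_mulHomogeneous, map_mul]
        obtain ⟨t, ht⟩ := hsπ b₁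
        have h2 : s r * s (π b₁) * g₀ = s r * (b₁ * g₀) - s r * t * (ℓ * g₀) := by
          linear_combination (-s r * g₀) * ht
        rw [h2]
        exact sub_mem (Ideal.mul_mem_left _ _ hb₁) (Ideal.mul_mem_left _ _ hℓ))
    have hM : Function.Injective M := by
      intro r r' hrr
      have h3 := congrArg (fun x => x.1.1) hrr
      exact Subtype.ext (mul_right_cancel₀ hb₁0 h3)
    have h4 := LinearMap.finrank_le_finrank_of_injective hM
    rw [finrank_homogeneousSubmodule_fin_two] at h4
    omega

end Defect

/-! ### Degrees in the resolution and the conclusion -/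

/-- The shift of the last module in the resolution is the sum of the exponents. -/
lemma IsSyzygyMatrix.sum_degree_eq {σ k : Type*} [Field k] {φ b : Fin 3 → MvPolynomial σ k}
    {A : Matrix (Fin 3) (Fin 3) (MvPolynomial σ k)} (H : IsSyzygyMatrix φ A b)
    (hφ' : IsPrimitive φ) {δ ε : ℤ} {α : Fin 3 → ℤ} (hφ : ∀ i, IsIntHomogeneous (φ i) δ)
    (hA : ∀ i j, IsIntHomogeneous (A i j) (α j)) (hb : ∀ i, IsIntHomogeneous (b i) (ε - α i)) :
    α 0 + α 1 + α 2 = ε + δ := by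
  obtain ⟨u, hu, hcross⟩ := H.exists_cross_col_eq hφ'
  obtain ⟨i, hi⟩ := H.isPrimitive.exists_ne_zero
  obtain ⟨j, hj⟩ := hφ'.exists_ne_zero
  have hu0 : IsIntHomogeneous u 0 := by
    obtain ⟨c, -, rfl⟩ := (MvPolynomial.isUnit_iff_eq_C_of_isReduced (P := u)).1 hu
    exact (isHomogeneous_C σ c).isIntHomogeneous
  -- A nonzero entry of the Hilbert–Burch relation has its degree computed in two ways.
  have h1 : IsIntHomogeneous ((u * b i) * φ j) (0 + (ε - α i) + δ) := (hu0.mul (hb i)).mul (hφ j)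
  have h2 : IsIntHomogeneous ((u * b i) * φ j) (α (i + 1) + α (i + 2)) := by
    have h3 := congrFun (hcross i) j
    rw [Pi.smul_apply, smul_eq_mul] at h3
    rw [← h3, cross_apply]
    have h4 : ∀ l m, IsIntHomogeneous
        (A l (i + 1) * A m (i + 2) - A m (i + 1) * A l (i + 2)) (α (i + 1) + α (i + 2)) :=
      fun l m => ((hA _ _).mul (hA _ _)).sub ((hA _ _).mul (hA _ _))
    fin_cases j
    · exact h4 1 2
    · exact h4 2 0
    · exact h4 0 1
  have h5 := h1.unique h2 (mul_ne_zero (mul_ne_zero hu.ne_zero hi) hj)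
  fin_cases i <;> simp at h5 <;> linarith

theorem isGreatest_dimN_of_isPlusOneGenerated {f : S} {d d₁ d₂ d₃ : ℕ}
    (h : IsPlusOneGenerated f d d₁ d₂ d₃) :
    IsGreatest (Set.range (dimN f)) (d₃ - d₂ + 1) := by
  obtain ⟨⟨hf, hsq, hmono, hpos, e, A, B, -, hA, hB, h₁, h₂, h₃, -, -, hBc⟩, hd⟩ := h
  have h12 : d₁ ≤ d₂ := hmono (show (0 : Fin 3) ≤ 1 by decide)
  have h23 : d₂ ≤ d₃ := hmono (show (1 : Fin 3) ≤ 2 by decide)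
  have hd1 : 1 ≤ d₁ := hpos 0
  have H := isSyzygyMatrix_of_exact (B := B) h₁ h₂ h₃
  set b : Fin 3 → S := fun i => B i (0 : Fin 1) with hbdef
  have hφ' := isPrimitive_pderiv (by omega) hf hsq
  have hφ : ∀ i, IsIntHomogeneous (pderiv i f) ((d : ℤ) - 1) := fun i => by
    have := (hf.pderiv (i := i)).isIntHomogeneous
    rwa [Nat.cast_sub (by omega), Nat.cast_one] at this
  let α : Fin 3 → ℤ := fun j => ((![d₁, d₂, d₃] j : ℕ) : ℤ)
  have hA' : ∀ i j, IsIntHomogeneous (A i j) (α j) := fun i j => by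
    have := hA i j
    rwa [sub_sub_cancel] at this
  have hb : ∀ i, IsIntHomogeneous (b i) (1 - d + e (0 : Fin 1) - α i) := fun i => by
    have := hB i (0 : Fin 1)
    rw [show (1 : ℤ) - d - (![d₁, d₂, d₃] i : ℕ) - -e (0 : Fin 1) =
      1 - d + e (0 : Fin 1) - α i by simp only [α]; ring] at this
    exact this
  -- With d₁ + d₂ = d this gives 1 - d + e = d₃ + 1, so `b i` has degree d₃ + 1 - `α i`.
  have he := H.sum_degree_eq hφ' hφ hA' hb
  have hα0 : α 0 = d₁ := rfl
  have hα1 : α 1 = d₂ := rfl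
  have hα2 : α 2 = d₃ := rfl
  have hbc : ∀ m, (constantCoeff : S →+* ℂ) (b m) = 0 := fun m => hBc m 0
  have hb2 := H.apply_two_ne_zero constantCoeff hbc
  have hb1 := H.not_dvd constantCoeff hbc
  have hβ0 : (b 0).IsHomogeneous (d₃ - d₁ + 1) := IsIntHomogeneous.isHomogeneous (by
    convert hb 0 using 1
    omega)
  have hβ1 : (b 1).IsHomogeneous (d₃ - d₂ + 1) := IsIntHomogeneous.isHomogeneous (by
    convert hb 1 using 1
    omega)
  have hβ2 : (b 2).IsHomogeneous 1 := IsIntHomogeneous.isHomogeneous (by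
    convert hb 2 using 1
    omega)
  obtain ⟨c, i, hi, hc⟩ := exists_eq_sum_smul_X hβ2 hb2
  obtain ⟨π, s, hπs, hker, hsπ, hπ, hs, -⟩ := exists_quotient_by_linear_form hi hc
  have hprim : IsPrimitive ![π (b 0), π (b 1)] :=
    H.isPrimitive_quotient π.toRingHom (fun p => ⟨s p, hπs p⟩) hb2 hker hb1
  have hK : KoszulExact b :=
    koszulExact_of_quotient π.toRingHom (fun p => ⟨s p, hπs p⟩) hb2 hker hprim
  -- The value of κ is forced by A = C * skew b: for j = 0, d₁ = (d₃ - d₂ + 1) + 1 + κ.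
  obtain ⟨C, g₀, hC, hg₀, hdeg⟩ := H.exists_homogeneous_generator (κ := (d : ℤ) - d₃ - 2) hK hφ
    hA' hb (fun j => by fin_cases j <;> simp <;> omega)
  have hann : ∀ h, h * g₀ ∈ jacobianIdeal f → ∃ x y z, h = x * b 0 + y * b 1 + z * b 2 := by
    intro h hh
    obtain ⟨t, ht⟩ := mem_jacobianIdeal.1 hh
    obtain ⟨v, hv⟩ := H.exists_combination_of_mul_generator_mem hC hg₀ ht
    exact ⟨v 0, v 1, v 2, by simpa [dotProduct, Fin.sum_univ_three] using hv⟩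
  have hmem : ∀ m, b m * g₀ ∈ jacobianIdeal f := fun m =>
    mem_jacobianIdeal.2 ⟨fun i => C i m, by rw [mul_comm]; exact congrFun hg₀ m⟩
  have hg₀0 : g₀ ≠ 0 := by
    rintro rfl
    obtain ⟨x, y, z, hxyz⟩ := hann 1 (by simp)
    simpa [hbc] using congrArg constantCoeff hxyz
  have hk₀ := hdeg.nonneg hg₀0
  obtain ⟨k₀, hk₀⟩ := Int.eq_ofNat_of_zero_le hk₀
  rw [hk₀] at hdeg
  have hgsat : g₀ ∈ saturation (jacobianIdeal f) := by
    -- Modulo `b 2`, all forms of degree deg `b 0` + deg `b 1` lie in the ideal of these two; the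
    -- summand 0 is the `j` of `exists_eq_add_of_isHomogeneous`.
    have hle : irrelevantIdeal ^ (0 + (d₃ - d₁ + 1) + (d₃ - d₂ + 1)) ≤
        Submodule.comap (LinearMap.mulRight S g₀) (jacobianIdeal f) := by
      refine irrelevantIdeal_pow_le fun p hp => ?_
      obtain ⟨x, y, hxy⟩ := hprim.exists_eq_add_of_isHomogeneous (hπ _ _ hβ0) (hπ _ _ hβ1)
        (hπ _ _ hp)
      obtain ⟨t, ht⟩ := (hker (p - s x * b 0 - s y * b 1)).1 (by
        rw [map_sub, map_sub, map_mul, map_mul, hπs, hπs, hxy]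
        ring)
      have h2 : p * g₀ = s x * (b 0 * g₀) + s y * (b 1 * g₀) + t * (b 2 * g₀) := by
        linear_combination g₀ * ht
      change p * g₀ ∈ jacobianIdeal f
      rw [h2]
      exact add_mem (add_mem (Ideal.mul_mem_left _ _ (hmem 0)) (Ideal.mul_mem_left _ _ (hmem 1)))
        (Ideal.mul_mem_left _ _ (hmem 2))
    exact ⟨_, fun h hh => hle hh⟩
  exact isGreatest_dimN hf (fun g hg => exists_eq_mul_of_mem_saturation H hK hC hg₀ hg) hgsat
    hdeg.isHomogeneous hs hπ hπs hsπ ((hker _).2 dvd_rfl) (hmem 2) (hmem 1)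
    (fun h => hb1 ((hker _).1 h)) hann hβ0 hβ1 (by omega) (by omega)

end PlaneCurve

theorem proposition3p7 (d : ℕ) (hd : 4 ≤ d) (L : PlaneCurve.LineArrangement d) (d₁ d₂ d₃ : ℕ)
    (hL : PlaneCurve.IsPlusOneGenerated L.equation d d₁ d₂ d₃) :
    IsGreatest (Set.range (PlaneCurve.dimN L.equation)) (PlaneCurve.defect L.equation) ∧
      (PlaneCurve.defect L.equation : ℤ) = (d₃ : ℤ) - (d₂ : ℤ) + 1 := by
  have h := PlaneCurve.isGreatest_dimN_of_isPlusOneGenerated hL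
  -- `sSup` on ℕ defaults to 0 for unbounded sets; the attained maximum excludes that case.
  have hdef : PlaneCurve.defect L.equation = d₃ - d₂ + 1 := h.csSup_eq
  have h23 : d₂ ≤ d₃ := hL.1.2.2.1 (show (1 : Fin 3) ≤ 2 by decide)
  refine ⟨hdef ▸ h, ?_⟩
  rw [hdef, Nat.cast_add, Nat.cast_sub h23, Nat.cast_one]
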